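/- For an integer $n\ge 1$ let $\Omega(n)$ denote the number of prime factors of $n$, counted with multiplicity. For each integer $k\ge1$ the series $$f_k=\sum_{\Omega(n)=k}\frac{1}{n\log n},$$ taken over all positive integers $n$ with $\Omega(n)=k$, converges, and $$f_k = 1+O\!\left(\frac{k}{2^{k/4}}\right)$$ uniformly for $k\ge1$; that is, there is an absolute constant $C$ such that $|f_k-1|\le C\,k\,2^{-k/4}$ for every integer $k\ge1$. -/

import Mathlib

/-- The general term `1 / (n log n)`, as a function on the `k`-almost primes, the natural numbers
with exactly `k` prime factors counted with multiplicity. For `k ≥ 1` all of these are `≥ 2`. -/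
noncomputable def almostPrimeTerm (k : ℕ) (n : {n : ℕ // ArithmeticFunction.cardFactors n = k}) :
    ℝ :=
  1 / ((n : ℝ) * Real.log (n : ℝ))

/-- The Erdős sum `f_k`, the sum of `1 / (n log n)` over all `k`-almost primes `n`. -/
noncomputable def erdosSum (k : ℕ) : ℝ :=
  ∑' n : {n : ℕ // ArithmeticFunction.cardFactors n = k}, almostPrimeTerm k n

open Complex Metric

/-! Integrating `n ^ (-(1 + t))` over `0 < t < 1` gives `1 / (n log n)` up to `1 / (n² log n)`. As
`n ≥ 2 ^ k` when `Ω n = k`, these errors sum to `O((4/5) ^ k)`, so `f_k` is essentially the integral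
over `(0, 1)` of `P_k(t)`, the Dirichlet series `almostPrimeZeta k t`.

The generating function `∑ z ^ k P_k(t)` is an Euler product (`tsum_omegaHom`). Removing `ζ(1 + t) ^
z`, hence `t ^ (-z)`, leaves a factor `G(t, z)` that is holomorphic for `|z| < 3/2`, bounded, and
within `O(t)` of `G(0, z)` (`exists_regFactor_bounds`). By Cauchy its Taylor coefficients satisfy
`g_j(t) = O((4/5) ^ j)` and `g_j(t) - g_j(0) = O(t (4/5) ^ j)`. Comparing coefficients, `P_k(t) =
∑_{i+j=k} (-log t) ^ i / i! * g_j(t)`.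

Each `(-log t) ^ i / i!` has integral `1` over `(0, 1)`, and integral `2 ^ (-(i+1))` against `t`. So
the integral of `P_k` is `∑_{j ≤ k} g_j(0) + O(k (4/5) ^ k)`, a partial sum of the series for `G(0,
1) = 1`. Finally `4/5 < 2 ^ (-1/4)`. -/

/-! ### Local Euler factors. -/

/-- The logarithm of the local factor `(1 - x) ^ z / (1 - z * x)`. -/
noncomputable def localLog (z : ℂ) (x : ℝ) : ℂ :=
  -log (1 - z * x) + z * log (1 - x)

theorem one_sub_mul_mem_slitPlane {z : ℂ} {x : ℝ} (hz : ‖z‖ ≤ 3 / 2) (hx0 : 0 ≤ x)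
    (hx : x ≤ 1 / 2) : 1 - z * x ∈ slitPlane := by
  refine Or.inl ?_
  have h1 : z.re ≤ 3 / 2 := (re_le_norm z).trans hz
  have : (1 - z * (x : ℂ)).re = 1 - z.re * x := by simp
  rw [this]
  nlinarith

theorem quarter_le_norm_one_sub_mul {z : ℂ} {x : ℝ} (hz : ‖z‖ ≤ 3 / 2) (hx0 : 0 ≤ x)
    (hx : x ≤ 1 / 2) : 1 / 4 ≤ ‖1 - z * x‖ := by
  have h1 : z.re ≤ 3 / 2 := (re_le_norm z).trans hz
  have : (1 - z * (x : ℂ)).re = 1 - z.re * x := by simp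
  refine le_trans ?_ (re_le_norm _)
  rw [this]
  nlinarith

theorem one_sub_mem_slitPlane {x : ℝ} (hx : x ≤ 1 / 2) : (1 - x : ℂ) ∈ slitPlane := by
  refine Or.inl ?_
  have : (1 - (x : ℂ)).re = 1 - x := by simp
  rw [this]; linarith

theorem hasDerivAt_localLog {z : ℂ} {x : ℝ} (hz : ‖z‖ ≤ 3 / 2) (hx0 : 0 ≤ x)
    (hx : x ≤ 1 / 2) :
    HasDerivAt (localLog z) (z * (z - 1) * x / ((1 - z * x) * (1 - x))) x := by
  have hA := one_sub_mul_mem_slitPlane hz hx0 hx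
  have hB := one_sub_mem_slitPlane hx
  have h0 : HasDerivAt (fun y : ℝ => (y : ℂ)) 1 x := ofRealCLM.hasDerivAt
  have h1 : HasDerivAt (fun y : ℝ => 1 - z * (y : ℂ)) (-(z * 1)) x :=
    (h0.const_mul z).const_sub 1
  have h2 : HasDerivAt (fun y : ℝ => 1 - (y : ℂ)) (-1) x := h0.const_sub 1
  have := (h1.clog_real hA).neg.add ((h2.clog_real hB).const_mul z)
  refine this.congr_deriv ?_
  have a := slitPlane_ne_zero hA
  have b := slitPlane_ne_zero hB
  field_simp
  ring

/-- Mean value inequality. The derivative carries a factor `x` because the linear terms of the two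
logarithms cancel; the constant is `(3/2)(5/2) / ((1/4)(1/2)) = 30`. -/
theorem norm_localLog_sub_le {z : ℂ} {x y : ℝ} (hz : ‖z‖ ≤ 3 / 2) (hx0 : 0 ≤ x) (hxy : x ≤ y)
    (hy : y ≤ 1 / 2) : ‖localLog z y - localLog z x‖ ≤ 30 * y * (y - x) := by
  have := (convex_Icc x y).norm_image_sub_le_of_norm_hasDerivWithin_le (f := localLog z)
    (f' := fun x => z * (z - 1) * x / ((1 - z * x) * (1 - x))) (C := 30 * y)
    (fun u hu => (hasDerivAt_localLog hz (hx0.trans hu.1) (hu.2.trans hy)).hasDerivWithinAt)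
    (fun u hu => ?_) (Set.left_mem_Icc.2 hxy) (Set.right_mem_Icc.2 hxy)
  · rwa [Real.norm_of_nonneg (by linarith)] at this
  · have h1 := quarter_le_norm_one_sub_mul hz (hx0.trans hu.1) (hu.2.trans hy)
    have h2 : 1 / 2 ≤ ‖(1 - u : ℂ)‖ := by
      refine le_trans ?_ (re_le_norm _)
      have : (1 - (u : ℂ)).re = 1 - u := by simp
      rw [this]; linarith [hu.2]
    have h3 : ‖z - 1‖ ≤ 5 / 2 := (norm_sub_le _ _).trans (by simp; linarith)
    have hu0 : 0 ≤ u := hx0.trans hu.1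
    rw [norm_div, norm_mul, norm_mul, norm_mul, norm_real, Real.norm_of_nonneg hu0,
      div_le_iff₀ (by positivity)]
    calc ‖z‖ * ‖z - 1‖ * u ≤ 3 / 2 * (5 / 2) * y := by gcongr; exact hu.2
      _ = 30 * y * (1 / 4 * (1 / 2)) := by ring
      _ ≤ _ := by
        have : 0 ≤ y := hu0.trans hu.2
        gcongr

theorem norm_localLog_le {z : ℂ} {x : ℝ} (hz : ‖z‖ ≤ 3 / 2) (hx0 : 0 ≤ x)
    (hx : x ≤ 1 / 2) : ‖localLog z x‖ ≤ 30 * x ^ 2 := by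
  have := norm_localLog_sub_le hz le_rfl hx0 hx
  simp only [localLog, ofReal_zero, mul_zero, sub_zero, log_one, neg_zero, add_zero] at this
  simpa [localLog, pow_two, mul_assoc] using this

theorem rpow_neg_le_half {t : ℝ} (ht : 0 ≤ t) (p : Nat.Primes) :
    ((p : ℕ) : ℝ) ^ (-(1 + t)) ≤ 1 / 2 := by
  have h2 : (2 : ℝ) ≤ ((p : ℕ) : ℝ) := by exact_mod_cast p.2.two_le
  calc ((p : ℕ) : ℝ) ^ (-(1 + t)) ≤ ((p : ℕ) : ℝ) ^ (-1 : ℝ) :=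
        Real.rpow_le_rpow_of_exponent_le (by linarith) (by linarith)
    _ = (((p : ℕ) : ℝ))⁻¹ := Real.rpow_neg_one _
    _ ≤ 1 / 2 := by rw [one_div]; exact inv_anti₀ (by norm_num) h2

/-- The summand attached to the prime `p` in the logarithm of the regularised Euler product. -/
noncomputable def primeTerm (t : ℝ) (z : ℂ) (p : Nat.Primes) : ℂ :=
  localLog z (((p : ℕ) : ℝ) ^ (-(1 + t)))

theorem norm_primeTerm_le {t : ℝ} (ht : 0 ≤ t) {z : ℂ} (hz : ‖z‖ ≤ 3 / 2) (p : Nat.Primes) :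
    ‖primeTerm t z p‖ ≤ 60 * ((p : ℕ) : ℝ) ^ (-(3 / 2) : ℝ) := by
  have h2 : (2 : ℝ) ≤ ((p : ℕ) : ℝ) := by exact_mod_cast p.2.two_le
  refine (norm_localLog_le hz (by positivity) (rpow_neg_le_half ht p)).trans ?_
  rw [← Real.rpow_natCast, ← Real.rpow_mul (by positivity)]
  have : ((p : ℕ) : ℝ) ^ (-(1 + t) * ((2 : ℕ) : ℝ)) ≤ ((p : ℕ) : ℝ) ^ (-(3 / 2) : ℝ) :=
    Real.rpow_le_rpow_of_exponent_le (by linarith) (by push_cast; linarith)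
  have h0 : 0 ≤ ((p : ℕ) : ℝ) ^ (-(3 / 2) : ℝ) := by positivity
  linarith

theorem norm_primeTerm_sub_le {t : ℝ} (ht : 0 ≤ t) {z : ℂ} (hz : ‖z‖ ≤ 3 / 2)
    (p : Nat.Primes) :
    ‖primeTerm t z p - primeTerm 0 z p‖ ≤ t * (60 * ((p : ℕ) : ℝ) ^ (-(3 / 2) : ℝ)) := by
  have h2 : (2 : ℝ) ≤ ((p : ℕ) : ℝ) := by exact_mod_cast p.2.two_le
  have hp0 : (0 : ℝ) < ((p : ℕ) : ℝ) := by linarith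
  set q : ℝ := ((p : ℕ) : ℝ) with hq
  have hle : q ^ (-(1 + t)) ≤ q ^ (-(1 + 0) : ℝ) :=
    Real.rpow_le_rpow_of_exponent_le (by linarith) (by linarith)
  have h := norm_localLog_sub_le hz (by positivity) hle (rpow_neg_le_half le_rfl p)
  rw [norm_sub_rev]
  refine h.trans ?_
  have e1 : q ^ (-(1 + 0) : ℝ) = q⁻¹ := by simp [Real.rpow_neg_one]
  have e2 : q ^ (-(1 + t)) = q⁻¹ * Real.exp (-(t * Real.log q)) := by
    rw [neg_add, Real.rpow_add hp0, Real.rpow_neg_one, Real.rpow_def_of_pos hp0]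
    ring_nf
  have e3 : 1 - Real.exp (-(t * Real.log q)) ≤ t * Real.log q := by
    linarith [Real.add_one_le_exp (-(t * Real.log q))]
  -- Trading `log q` for `2 q ^ (1/2)` keeps the sum over primes convergent and turns `30` into
  -- `60`.
  have e4 : Real.log q ≤ q ^ (1 / 2 : ℝ) / (1 / 2) :=
    Real.log_le_rpow_div hp0.le (by norm_num)
  have e5 : q ^ (-(3 / 2) : ℝ) = q⁻¹ * q⁻¹ * q ^ (1 / 2 : ℝ) := by
    rw [← Real.rpow_neg_one, ← Real.rpow_add hp0, ← Real.rpow_add hp0]; norm_num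
  rw [e1, e2, e5]
  calc 30 * q⁻¹ * (q⁻¹ - q⁻¹ * Real.exp (-(t * Real.log q)))
      = 30 * q⁻¹ * q⁻¹ * (1 - Real.exp (-(t * Real.log q))) := by ring
    _ ≤ 30 * q⁻¹ * q⁻¹ * (t * (q ^ (1 / 2 : ℝ) / (1 / 2))) := by
        gcongr
        exact e3.trans (by gcongr)
    _ = _ := by ring

theorem summable_primes_rpow :
    Summable fun p : Nat.Primes => 60 * ((p : ℕ) : ℝ) ^ (-(3 / 2) : ℝ) :=
  ((Real.summable_nat_rpow.2 (by norm_num)).subtype Nat.Prime).mul_left 60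

theorem summable_primeTerm {t : ℝ} (ht : 0 ≤ t) {z : ℂ} (hz : ‖z‖ ≤ 3 / 2) :
    Summable (primeTerm t z) :=
  .of_norm_bounded summable_primes_rpow (norm_primeTerm_le ht hz)

/-! ### The zeta function near its pole. -/

/-- The sum `ζ (1 + t)` over the positive integers. -/
noncomputable def zetaSum (t : ℝ) : ℝ := ∑' n : ℕ, 1 / (n + 1 : ℝ) ^ (1 + t)

/-- The terms decrease in `s`, and at `s = 1` they sum to `1 - γ < 1/2`. The value `1/2` keeps `1 -
s * termTSum s` nonnegative up to `s = 2`. -/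
theorem termTSum_le {s : ℝ} (hs : 1 < s) : ZetaAsymptotics.termTSum s ≤ 1 / 2 := by
  have hle : ∀ n : ℕ, ZetaAsymptotics.term (n + 1) s ≤ ZetaAsymptotics.term (n + 1) 1 := by
    intro n
    rw [ZetaAsymptotics.term, ZetaAsymptotics.term]
    refine intervalIntegral.integral_mono_on (by simp)
      (ZetaAsymptotics.term_welldef n.succ_pos (by linarith))
      (ZetaAsymptotics.term_welldef n.succ_pos zero_lt_one) (fun x hx => ?_)
    have : 1 ≤ x := le_trans (by simp) hx.1
    gcongr
    exact sub_nonneg.2 hx.1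
  have h1 := ZetaAsymptotics.term_tsum_one
  have h2 : Summable fun n : ℕ => ZetaAsymptotics.term (n + 1) s :=
    .of_nonneg_of_le (fun n => ZetaAsymptotics.term_nonneg _ _) hle h1.summable
  have h3 := h2.tsum_le_tsum hle h1.summable
  rw [h1.tsum_eq] at h3
  exact h3.trans (by linarith [Real.one_half_lt_eulerMascheroniConstant])

theorem mul_zetaSum_bounds {t : ℝ} (ht : 0 < t) (ht1 : t ≤ 1) :
    1 ≤ t * zetaSum t ∧ t * zetaSum t ≤ 1 + t := by
  have h1 := ZetaAsymptotics.zeta_limit_aux1 (s := 1 + t) (by linarith)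
  have h2 := termTSum_le (s := 1 + t) (by linarith)
  change zetaSum t - _ = _ at h1
  have h3 : 0 ≤ ZetaAsymptotics.termTSum (1 + t) :=
    tsum_nonneg fun n => ZetaAsymptotics.term_nonneg _ _
  rw [add_sub_cancel_left] at h1
  constructor
  · have : 1 / t ≤ zetaSum t := by nlinarith
    calc 1 = t * (1 / t) := by field_simp
      _ ≤ t * zetaSum t := by gcongr
  · have : zetaSum t ≤ 1 / t + 1 := by nlinarith
    calc t * zetaSum t ≤ t * (1 / t + 1) := by gcongr
      _ = 1 + t := by field_simp

/-- The logarithm of `t * ζ (1 + t)`, with the value `0` at `t = 0`. -/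
noncomputable def logResidue (t : ℝ) : ℝ := Real.log (t * zetaSum t)

theorem abs_logResidue_le {t : ℝ} (ht : 0 ≤ t) (ht1 : t ≤ 1) : |logResidue t| ≤ t := by
  rcases ht.eq_or_lt with rfl | ht
  -- `Real.log 0 = 0` is here the true limit, since `t ζ(1 + t) → 1`.
  · simp [logResidue]
  · obtain ⟨h1, h2⟩ := mul_zetaSum_bounds ht ht1
    rw [logResidue, abs_of_nonneg (Real.log_nonneg h1)]
    calc Real.log (t * zetaSum t) ≤ t * zetaSum t - 1 := Real.log_le_sub_one_of_pos (by linarith)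
      _ ≤ t := by linarith

/-! ### The regularised factor: bounds and holomorphy. -/

/-- The exponent in the regularised Euler product. -/
noncomputable def regExponent (t : ℝ) (z : ℂ) : ℂ :=
  z * logResidue t + ∑' p : Nat.Primes, primeTerm t z p

/-- The factor `G` in `∑ z ^ Ω n / n ^ (1 + t) = t ^ (-z) * G t z`. -/
noncomputable def regFactor (t : ℝ) (z : ℂ) : ℂ := exp (regExponent t z)

theorem exists_regExponent_bounds : ∃ C : ℝ, 0 ≤ C ∧ ∀ t : ℝ, 0 ≤ t → t ≤ 1 → ∀ z : ℂ,
    ‖z‖ ≤ 3 / 2 → ‖regExponent t z‖ ≤ C ∧ ‖regExponent t z - regExponent 0 z‖ ≤ C * t := by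
  set S := ∑' p : Nat.Primes, 60 * ((p : ℕ) : ℝ) ^ (-(3 / 2) : ℝ)
  have hS : 0 ≤ S := tsum_nonneg fun p => by positivity
  refine ⟨3 / 2 + S, by positivity, fun t ht ht1 z hz => ⟨?_, ?_⟩⟩
  · have h1 : ‖z * logResidue t‖ ≤ 3 / 2 * 1 := by
      rw [norm_mul, norm_real]
      gcongr
      exact (abs_logResidue_le ht ht1).trans ht1
    have h2 : ‖∑' p, primeTerm t z p‖ ≤ S :=
      tsum_of_norm_bounded summable_primes_rpow.hasSum (norm_primeTerm_le ht hz)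
    exact (norm_add_le _ _).trans (by linarith)
  · have h1 : ‖z * logResidue t‖ ≤ 3 / 2 * t := by
      rw [norm_mul, norm_real]
      gcongr
      exact abs_logResidue_le ht ht1
    have h2 : ‖∑' p, (primeTerm t z p - primeTerm 0 z p)‖ ≤ t * S :=
      tsum_of_norm_bounded (summable_primes_rpow.hasSum.mul_left t) (norm_primeTerm_sub_le ht hz)
    rw [(summable_primeTerm ht hz).tsum_sub (summable_primeTerm le_rfl hz)] at h2
    have : regExponent t z - regExponent 0 z = z * logResidue t +
        (∑' p, primeTerm t z p - ∑' p, primeTerm 0 z p) := by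
      simp only [regExponent, show logResidue 0 = 0 by simp [logResidue]]
      push_cast; ring
    rw [this]
    exact (norm_add_le _ _).trans (by linarith)

theorem norm_exp_sub_exp_le {C : ℝ} {a b : ℂ} (ha : ‖a‖ ≤ C) (hb : ‖b‖ ≤ C) :
    ‖exp a - exp b‖ ≤ Real.exp C * ‖a - b‖ := by
  refine (convex_closedBall (0 : ℂ) C).norm_image_sub_le_of_norm_hasDerivWithin_le
    (fun x _ => (hasDerivAt_exp x).hasDerivWithinAt) (fun x hx => ?_) (by simpa) (by simpa)
  rw [norm_exp]
  exact Real.exp_le_exp.2 ((re_le_norm x).trans (by simpa using hx))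

theorem exists_regFactor_bounds : ∃ C : ℝ, 0 ≤ C ∧ ∀ t : ℝ, 0 ≤ t → t ≤ 1 → ∀ z : ℂ,
    ‖z‖ ≤ 3 / 2 → ‖regFactor t z‖ ≤ C ∧ ‖regFactor t z - regFactor 0 z‖ ≤ C * t := by
  obtain ⟨C, hC, h⟩ := exists_regExponent_bounds
  refine ⟨Real.exp C * (1 + C), by positivity, fun t ht ht1 z hz => ?_⟩
  obtain ⟨h1, h2⟩ := h t ht ht1 z hz
  obtain ⟨h3, -⟩ := h 0 le_rfl zero_le_one z hz
  constructor
  · rw [regFactor, norm_exp]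
    have : Real.exp (regExponent t z).re ≤ Real.exp C :=
      Real.exp_le_exp.2 ((re_le_norm _).trans h1)
    nlinarith [Real.exp_pos C]
  · refine (norm_exp_sub_exp_le h1 h3).trans ?_
    have := mul_le_mul_of_nonneg_left h2 (Real.exp_pos C).le
    nlinarith [mul_nonneg (Real.exp_pos C).le ht]

theorem differentiableOn_regFactor {t : ℝ} (ht : 0 ≤ t) :
    DifferentiableOn ℂ (regFactor t) (ball 0 (3 / 2)) := by
  refine DifferentiableOn.cexp (DifferentiableOn.add (by fun_prop) ?_)
  refine differentiableOn_tsum_of_summable_norm summable_primes_rpow (fun p => ?_) isOpen_ball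
    (fun p z hz => norm_primeTerm_le ht (by simpa using (mem_ball_zero_iff.1 hz).le) p)
  intro z hz
  have := one_sub_mul_mem_slitPlane (mem_ball_zero_iff.1 hz).le
    (x := ((p : ℕ) : ℝ) ^ (-(1 + t))) (by positivity) (rpow_neg_le_half ht p)
  unfold primeTerm localLog
  refine DifferentiableAt.differentiableWithinAt ?_
  exact ((by fun_prop : DifferentiableAt ℂ
    (fun z : ℂ => 1 - z * ((((p : ℕ) : ℝ) ^ (-(1 + t)) : ℝ) : ℂ)) z).clog this).neg.add
    (by fun_prop)

/-- At `z = 1` every local factor is trivial; this is the source of the limit `1`. -/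
theorem regFactor_zero_one : regFactor 0 1 = 1 := by
  simp [regFactor, regExponent, logResidue, primeTerm, localLog]

/-! ### The Euler product. -/

/-- The completely multiplicative function `n ↦ z ^ Ω n / n ^ (1 + t)`. -/
noncomputable def omegaHom {t : ℝ} (ht : 0 < t) (z : ℂ) : ℕ →*₀ ℂ where
  toFun n := z ^ ArithmeticFunction.cardFactors n * (((n : ℝ) ^ (-(1 + t)) : ℝ) : ℂ)
  map_zero' := by rw [Nat.cast_zero, Real.zero_rpow (by linarith : -(1 + t) ≠ 0)]; simp
  map_one' := by simp
  map_mul' m n := by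
    rcases eq_or_ne m 0 with rfl | hm
    · simp only [zero_mul, mul_zero, Nat.cast_zero, Real.zero_rpow (by linarith : -(1 + t) ≠ 0),
        ofReal_zero]
    rcases eq_or_ne n 0 with rfl | hn
    · simp only [mul_zero, Nat.cast_zero, Real.zero_rpow (by linarith : -(1 + t) ≠ 0),
        ofReal_zero]
    rw [ArithmeticFunction.cardFactors_mul hm hn, Nat.cast_mul,
      Real.mul_rpow (by positivity) (by positivity)]
    push_cast
    ring

theorem omegaHom_apply {t : ℝ} (ht : 0 < t) (z : ℂ) (n : ℕ) : omegaHom ht z n =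
    z ^ ArithmeticFunction.cardFactors n * (((n : ℝ) ^ (-(1 + t)) : ℝ) : ℂ) := rfl

theorem summable_rpow_neg {t : ℝ} (ht : 0 < t) : Summable fun n : ℕ => (n : ℝ) ^ (-(1 + t)) :=
  Real.summable_nat_rpow.2 (by linarith)

theorem summable_norm_omegaHom {t : ℝ} (ht : 0 < t) {z : ℂ} (hz : ‖z‖ ≤ 1) :
    Summable fun n => ‖omegaHom ht z n‖ := by
  refine .of_nonneg_of_le (fun n => norm_nonneg _) (fun n => ?_) (summable_rpow_neg ht)
  rw [omegaHom_apply, norm_mul, norm_pow, norm_real, Real.norm_of_nonneg (by positivity)]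
  exact mul_le_of_le_one_left (by positivity) (pow_le_one₀ (norm_nonneg _) hz)

theorem tsum_primes_log_eq_log_zetaSum {t : ℝ} (ht : 0 < t) :
    0 < zetaSum t ∧ ∑' p : Nat.Primes, -log (1 - ((((p : ℕ) : ℝ) ^ (-(1 + t)) : ℝ) : ℂ)) =
      (Real.log (zetaSum t) : ℂ) := by
  have h := EulerProduct.exp_tsum_primes_log_eq_tsum
    (summable_norm_omegaHom ht (z := 1) (by simp))
  simp only [omegaHom_apply, one_pow, one_mul] at h
  have hz : ∑' n : ℕ, (n : ℝ) ^ (-(1 + t)) = zetaSum t := by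
    rw [(summable_rpow_neg ht).tsum_eq_zero_add, zetaSum]
    simp only [Nat.cast_zero, Real.zero_rpow (by linarith : -(1 + t) ≠ 0), zero_add]
    refine tsum_congr fun n => ?_
    rw [Real.rpow_neg (by positivity), one_div]; push_cast; rfl
  have hlog : ∑' p : Nat.Primes, -log (1 - ((((p : ℕ) : ℝ) ^ (-(1 + t)) : ℝ) : ℂ)) =
      ((∑' p : Nat.Primes, -Real.log (1 - ((p : ℕ) : ℝ) ^ (-(1 + t))) : ℝ) : ℂ) := by
    rw [ofReal_tsum]
    refine tsum_congr fun p => ?_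
    have := rpow_neg_le_half ht.le p
    rw [ofReal_neg, ofReal_log (by linarith)]
    push_cast; rfl
  -- Everything is real here, so taking the logarithm involves no choice of branch.
  rw [← ofReal_tsum, hz, hlog, ← ofReal_exp, ofReal_inj] at h
  rw [hlog, ← h, Real.log_exp]
  exact ⟨Real.exp_pos _, rfl⟩

theorem tsum_omegaHom {t : ℝ} (ht : 0 < t) {z : ℂ} (hz : ‖z‖ ≤ 1) :
    ∑' n, omegaHom ht z n = exp (z * (-Real.log t : ℝ)) * regFactor t z := by
  have hs (w : ℂ) (hw : ‖w‖ ≤ 1) : Summable fun p : Nat.Primes =>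
      log (1 - w * ((((p : ℕ) : ℝ) ^ (-(1 + t)) : ℝ) : ℂ)) := by
    have h := ((summable_norm_omegaHom ht hw).of_norm.subtype Nat.Prime).clog_one_sub
    refine h.congr fun p => ?_
    change log (1 - omegaHom ht w (p : ℕ)) = _
    rw [omegaHom_apply, ArithmeticFunction.cardFactors_apply_prime p.2, pow_one]
  obtain ⟨h0, h1⟩ := tsum_primes_log_eq_log_zetaSum ht
  have h := EulerProduct.exp_tsum_primes_log_eq_tsum (summable_norm_omegaHom ht hz)
  rw [← h, regFactor, ← exp_add]
  congr 1
  have hs1 := hs 1 (by simp)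
  simp only [one_mul] at hs1
  rw [regExponent, logResidue, Real.log_mul ht.ne' h0.ne']
  have : ∑' p : Nat.Primes, primeTerm t z p =
      ∑' p : Nat.Primes, -log (1 - z * ((((p : ℕ) : ℝ) ^ (-(1 + t)) : ℝ) : ℂ)) +
      z * (-(Real.log (zetaSum t) : ℂ)) := by
    rw [← h1, tsum_neg (f := fun p : Nat.Primes =>
      log (1 - ((((p : ℕ) : ℝ) ^ (-(1 + t)) : ℝ) : ℂ))), neg_neg, ← tsum_mul_left,
      ← (hs z hz).neg.tsum_add (hs1.mul_left z)]
    rfl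
  rw [this]
  have h2 : ∀ p : Nat.Primes, omegaHom ht z (p : ℕ) =
      z * ((((p : ℕ) : ℝ) ^ (-(1 + t)) : ℝ) : ℂ) := fun p => by
    rw [omegaHom_apply, ArithmeticFunction.cardFactors_apply_prime p.2, pow_one]
  simp only [h2]
  push_cast
  ring

/-! ### Generating function over `k` and its coefficients. -/

/-- The Dirichlet series `∑ n ^ (-(1 + t))` over the `k`-almost primes. -/
noncomputable def almostPrimeZeta (k : ℕ) (t : ℝ) : ℝ :=
  ∑' n : {n : ℕ // ArithmeticFunction.cardFactors n = k}, ((n : ℕ) : ℝ) ^ (-(1 + t))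

theorem hasSum_almostPrimeZeta {t : ℝ} (ht : 0 < t) {z : ℂ} (hz : ‖z‖ ≤ 1) :
    HasSum (fun k : ℕ => z ^ k * (almostPrimeZeta k t : ℂ)) (∑' n, omegaHom ht z n) := by
  have h := (summable_norm_omegaHom ht hz).of_norm.hasSum
  rw [← (Equiv.sigmaFiberEquiv
    (fun n : ℕ => ArithmeticFunction.cardFactors n)).hasSum_iff] at h
  refine h.sigma fun k => ?_
  have h2 := (hasSum_ofReal.2 ((summable_rpow_neg ht).subtype
    {n | ArithmeticFunction.cardFactors n = k}).hasSum).mul_left (z ^ k)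
  convert! h2 using 1
  ext n
  change z ^ ArithmeticFunction.cardFactors (n : ℕ) * _ = _
  rw [n.2]
  rfl

/-- The Taylor coefficients of `regFactor t` at `0`. -/
noncomputable def regCoeff (t : ℝ) (j : ℕ) : ℂ :=
  (j.factorial : ℂ)⁻¹ * iteratedDeriv j (regFactor t) 0

theorem hasSum_regCoeff {t : ℝ} (ht : 0 ≤ t) {z : ℂ} (hz : ‖z‖ < 3 / 2) :
    HasSum (fun j => z ^ j * regCoeff t j) (regFactor t z) := by
  have := hasSum_taylorSeries_on_ball (differentiableOn_regFactor ht)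
    (mem_ball_zero_iff.2 hz)
  convert! this using 1
  refine funext fun j => ?_
  simp [regCoeff]; ring

theorem powerSeries_coeff_unique {a b : ℕ → ℂ} {f : ℂ → ℂ}
    (ha : ∀ z, ‖z‖ < 1 → HasSum (fun n => z ^ n * a n) (f z))
    (hb : ∀ z, ‖z‖ < 1 → HasSum (fun n => z ^ n * b n) (f z)) : a = b := by
  have key (c : ℕ → ℂ) (hc : ∀ z, ‖z‖ < 1 → HasSum (fun n => z ^ n * c n) (f z)) :
      HasFPowerSeriesAt f (FormalMultilinearSeries.ofScalars ℂ c) 0 := by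
    rw [hasFPowerSeriesAt_iff]
    filter_upwards [ball_mem_nhds (0 : ℂ) one_pos] with z hz
    simpa [FormalMultilinearSeries.coeff_ofScalars] using hc z (mem_ball_zero_iff.1 hz)
  exact FormalMultilinearSeries.ofScalars_series_injective ℂ ℂ
    ((key a ha).eq_formalMultilinearSeries (key b hb))

/-- Cauchy product of the series of `t ^ (-z)` and of `G(t, z)`, compared with the grouping by `Ω`
on the unit disc. -/
theorem almostPrimeZeta_eq_sum {t : ℝ} (ht : 0 < t) (k : ℕ) :
    (almostPrimeZeta k t : ℂ) = ∑ ij ∈ Finset.HasAntidiagonal.antidiagonal k,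
      (((-Real.log t) ^ ij.1 / ij.1.factorial : ℝ) : ℂ) * regCoeff t ij.2 := by
  refine congr_fun (powerSeries_coeff_unique (a := fun k => (almostPrimeZeta k t : ℂ))
    (b := fun k => ∑ ij ∈ Finset.HasAntidiagonal.antidiagonal k,
      (((-Real.log t) ^ ij.1 / ij.1.factorial : ℝ) : ℂ) * regCoeff t ij.2)
    (fun z hz => hasSum_almostPrimeZeta ht hz.le) (fun z hz => ?_)) k
  rw [tsum_omegaHom ht hz.le]
  have h1 : HasSum (fun i : ℕ => (z * (-Real.log t : ℝ)) ^ i / i.factorial)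
      (exp (z * (-Real.log t : ℝ))) := by
    rw [exp_eq_exp_ℂ]
    exact NormedSpace.expSeries_div_hasSum_exp _
  have h2 := hasSum_regCoeff ht.le (hz.trans (by norm_num : (1 : ℝ) < 3 / 2))
  have n1 := summable_norm_iff.2 h1.summable
  have n2 := summable_norm_iff.2 h2.summable
  have h3 := summable_norm_sum_mul_antidiagonal_of_summable_norm n1 n2
  have h4 := tsum_mul_tsum_eq_tsum_sum_antidiagonal_of_summable_norm n1 n2
  rw [h1.tsum_eq, h2.tsum_eq] at h4
  rw [h4]
  convert! h3.of_norm.hasSum using 1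
  refine funext fun n => ?_
  rw [Finset.mul_sum]
  refine Finset.sum_congr rfl fun ij hij => ?_
  rw [← Finset.HasAntidiagonal.mem_antidiagonal.1 hij, pow_add, mul_pow]
  push_cast
  ring

/-- Cauchy's estimate on the circle of radius `5/4`, between `1` and `3/2`. -/
theorem norm_taylorCoeff_le {f : ℂ → ℂ} (hf : DifferentiableOn ℂ f (ball 0 (3 / 2))) {B : ℝ}
    (hB : ∀ z, ‖z‖ ≤ 3 / 2 → ‖f z‖ ≤ B) (j : ℕ) :
    ‖(j.factorial : ℂ)⁻¹ * iteratedDeriv j f 0‖ ≤ B * (4 / 5) ^ j := by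
  have hd : DiffContOnCl ℂ f (ball 0 (5 / 4)) := by
    refine (hf.mono ?_).diffContOnCl
    rw [closure_ball _ (by norm_num)]
    exact closedBall_subset_ball (by norm_num)
  have := norm_iteratedDeriv_le_of_forall_mem_sphere_norm_le j (by norm_num) hd
    (C := B) (fun z hz => hB z ?_)
  · rw [norm_mul, norm_inv, norm_natCast]
    have hj : (0 : ℝ) < j.factorial := by positivity
    rw [inv_mul_le_iff₀ hj]
    refine this.trans_eq ?_
    rw [div_eq_mul_inv, ← inv_pow]; norm_num; ring
  · rw [mem_sphere_zero_iff_norm.1 hz]; norm_num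

theorem exists_regCoeff_bounds : ∃ C : ℝ, 0 ≤ C ∧ ∀ t : ℝ, 0 ≤ t → t ≤ 1 → ∀ j : ℕ,
    ‖regCoeff t j‖ ≤ C * (4 / 5) ^ j ∧ ‖regCoeff t j - regCoeff 0 j‖ ≤ C * t * (4 / 5) ^ j := by
  obtain ⟨C, hC, h⟩ := exists_regFactor_bounds
  refine ⟨C, hC, fun t ht ht1 j => ⟨?_, ?_⟩⟩
  · exact norm_taylorCoeff_le (differentiableOn_regFactor ht) (fun z hz => (h t ht ht1 z hz).1) j
  · have := norm_taylorCoeff_le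
      ((differentiableOn_regFactor ht).sub (differentiableOn_regFactor le_rfl))
      (fun z hz => (h t ht ht1 z hz).2) j
    have hn (s : ℝ) (hs : 0 ≤ s) : ContDiffAt ℂ j (regFactor s) 0 :=
      ((differentiableOn_regFactor hs).contDiffOn isOpen_ball).contDiffAt
        (ball_mem_nhds _ (by norm_num))
    rwa [iteratedDeriv_sub (hn t ht) (hn 0 le_rfl), mul_sub] at this

/-! ### Integrals over `(0, 1)`. -/

-- The substitution `t = exp (-x)` turns this into a Gamma integral.
open MeasureTheory Set in
theorem integral_neg_log_pow_mul_pow (i m : ℕ) :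
    ∫ t in Ioo (0 : ℝ) 1, (-Real.log t) ^ i / i.factorial * t ^ m =
      (1 / ((m : ℝ) + 1)) ^ (i + 1) := by
  have himg : (fun x : ℝ => Real.exp (-x)) '' Ioi 0 = Ioo 0 1 := by
    ext y
    constructor
    · rintro ⟨x, hx, rfl⟩
      exact ⟨Real.exp_pos _, by simpa using hx⟩
    · rintro ⟨h0, h1⟩
      exact ⟨-Real.log y, by simpa using Real.log_neg h0 h1, by simp [Real.exp_log h0]⟩
  have h := integral_image_eq_integral_abs_deriv_smul (s := Ioi (0 : ℝ)) measurableSet_Ioi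
    (f := fun x => Real.exp (-x)) (f' := fun x => Real.exp (-x) * (-1))
    (fun x _ => ((hasDerivAt_neg x).exp).hasDerivWithinAt)
    (fun x _ y _ hxy => by simpa using hxy)
    (fun t => (-Real.log t) ^ i / i.factorial * t ^ m)
  have hG := Real.integral_rpow_mul_exp_neg_mul_Ioi (a := (i : ℝ) + 1) (r := (m : ℝ) + 1)
    (by positivity) (by positivity)
  rw [himg] at h
  rw [h]
  have : ∀ x ∈ Ioi (0 : ℝ), |Real.exp (-x) * (-1)| •
      ((-Real.log (Real.exp (-x))) ^ i / i.factorial * Real.exp (-x) ^ m) =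
      (i.factorial : ℝ)⁻¹ * (x ^ ((i : ℝ) + 1 - 1) * Real.exp (-(((m : ℝ) + 1) * x))) := by
    intro x _
    rw [add_sub_cancel_right, Real.rpow_natCast, Real.log_exp, neg_neg, mul_neg_one, abs_neg,
      abs_of_pos (Real.exp_pos _), smul_eq_mul, ← Real.exp_nat_mul,
      show -(((m : ℝ) + 1) * x) = -x + m * -x by ring, Real.exp_add]
    ring
  rw [setIntegral_congr_fun measurableSet_Ioi this, integral_const_mul, hG,
    Real.Gamma_nat_eq_factorial, ← Nat.cast_succ i, Real.rpow_natCast]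
  have : (i.factorial : ℝ) ≠ 0 := by positivity
  field_simp

open MeasureTheory Set in
theorem integrableOn_neg_log_pow_mul_pow (i m : ℕ) :
    IntegrableOn (fun t : ℝ => (-Real.log t) ^ i / i.factorial * t ^ m) (Ioo 0 1) :=
  -- A non-integrable function has integral `0` by convention, so a positive value gives
  -- integrability.
  .of_integral_ne_zero (by rw [integral_neg_log_pow_mul_pow]; positivity)

open MeasureTheory Set in
theorem integral_neg_log_pow (i : ℕ) :
    ∫ t in Ioo (0 : ℝ) 1, (-Real.log t) ^ i / i.factorial = 1 := by
  simpa using integral_neg_log_pow_mul_pow i 0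

open MeasureTheory Set in
theorem integrableOn_neg_log_pow (i : ℕ) :
    IntegrableOn (fun t : ℝ => (-Real.log t) ^ i / i.factorial) (Ioo 0 1) := by
  simpa using integrableOn_neg_log_pow_mul_pow i 0

theorem neg_log_pow_nonneg {t : ℝ} (ht : t ∈ Set.Ioo (0 : ℝ) 1) (i : ℕ) :
    0 ≤ (-Real.log t) ^ i / i.factorial := by
  have := Real.log_neg ht.1 ht.2
  have : 0 ≤ -Real.log t := by linarith
  positivity

theorem hasSum_rpow_almostPrimeZeta (k : ℕ) {t : ℝ} (ht : 0 < t) :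
    HasSum (fun n : {n : ℕ // ArithmeticFunction.cardFactors n = k} =>
      ((n : ℕ) : ℝ) ^ (-(1 + t))) (almostPrimeZeta k t) :=
  ((summable_rpow_neg ht).subtype {n | ArithmeticFunction.cardFactors n = k}).hasSum

open MeasureTheory Set in
theorem integrableOn_almostPrimeZeta (k : ℕ) : IntegrableOn (almostPrimeZeta k) (Ioo 0 1) := by
  obtain ⟨C, hC, h⟩ := exists_regCoeff_bounds
  refine Integrable.mono' (g := fun t : ℝ => ∑ ij ∈ Finset.HasAntidiagonal.antidiagonal k,
      (-Real.log t) ^ ij.1 / ij.1.factorial * (C * (4 / 5) ^ ij.2))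
    (integrable_finsetSum _ fun ij _ => (integrableOn_neg_log_pow ij.1).mul_const _) ?_ ?_
  · refine aestronglyMeasurable_of_tendsto_ae Filter.atTop
      (f := fun (s : Finset {n : ℕ // ArithmeticFunction.cardFactors n = k}) (t : ℝ) =>
        ∑ n ∈ s, ((n : ℕ) : ℝ) ^ (-(1 + t))) (fun s => ?_) ?_
    · exact (by fun_prop : Measurable fun t : ℝ =>
        ∑ n ∈ s, ((n : ℕ) : ℝ) ^ (-(1 + t))).aestronglyMeasurable
    · filter_upwards [ae_restrict_mem measurableSet_Ioo] with t ht
      exact hasSum_rpow_almostPrimeZeta k ht.1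
  · filter_upwards [ae_restrict_mem measurableSet_Ioo] with t ht
    rw [← norm_real, almostPrimeZeta_eq_sum ht.1]
    refine (norm_sum_le _ _).trans (Finset.sum_le_sum fun ij _ => ?_)
    rw [norm_mul, norm_real, Real.norm_of_nonneg (neg_log_pow_nonneg ht _)]
    exact mul_le_mul_of_nonneg_left (h t ht.1.le ht.2.le _).1 (neg_log_pow_nonneg ht _)

open MeasureTheory Set in
theorem hasSum_integral_rpow (k : ℕ) :
    HasSum (fun n : {n : ℕ // ArithmeticFunction.cardFactors n = k} =>
      ∫ t in Ioo (0 : ℝ) 1, ((n : ℕ) : ℝ) ^ (-(1 + t)))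
      (∫ t in Ioo (0 : ℝ) 1, almostPrimeZeta k t) := by
  refine hasSum_integral_of_dominated_convergence
    (fun (n : {n : ℕ // ArithmeticFunction.cardFactors n = k}) (t : ℝ) =>
      ((n : ℕ) : ℝ) ^ (-(1 + t))) (fun n => ?_) (fun n => ?_) ?_ ?_ ?_
  · exact (by fun_prop : Measurable fun t : ℝ => ((n : ℕ) : ℝ) ^ (-(1 + t))).aestronglyMeasurable
  · exact Filter.Eventually.of_forall fun t => (Real.norm_of_nonneg (by positivity)).le
  · filter_upwards [ae_restrict_mem measurableSet_Ioo] with t ht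
    exact (hasSum_rpow_almostPrimeZeta k ht.1).summable
  · exact integrableOn_almostPrimeZeta k
  · filter_upwards [ae_restrict_mem measurableSet_Ioo] with t ht
    exact hasSum_rpow_almostPrimeZeta k ht.1

open MeasureTheory Set in
theorem integral_rpow_neg_one_add {x : ℝ} (hx : 1 < x) :
    ∫ t in Ioo (0 : ℝ) 1, x ^ (-(1 + t)) =
      1 / (x * Real.log x) - 1 / (x ^ 2 * Real.log x) := by
  have hx0 : 0 < x := by linarith
  have hl : Real.log x ≠ 0 := (Real.log_pos hx).ne'
  rw [← integral_Ioc_eq_integral_Ioo, ← intervalIntegral.integral_of_le zero_le_one]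
  have hd : ∀ t ∈ uIcc (0 : ℝ) 1, HasDerivAt (fun t => -(x ^ (-(1 + t)) / Real.log x))
      (x ^ (-(1 + t))) t := fun t _ => by
    have h1 : HasDerivAt (fun t : ℝ => -(1 + t)) (-1) t := ((hasDerivAt_id t).const_add 1).neg
    have := ((h1.const_rpow hx0).div_const (Real.log x)).neg
    refine this.congr_deriv ?_
    field_simp
  rw [intervalIntegral.integral_eq_sub_of_hasDerivAt hd]
  · have e1 : x ^ (-(1 + 0) : ℝ) = x⁻¹ := by simp [Real.rpow_neg_one]
    have e2 : x ^ (-(1 + 1) : ℝ) = (x ^ 2)⁻¹ := by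
      rw [Real.rpow_neg hx0.le, one_add_one_eq_two, Real.rpow_two]
    rw [e1, e2]
    field_simp
    ring
  · exact (Continuous.rpow (by fun_prop) (by fun_prop)
      (fun t => Or.inl hx0.ne')).intervalIntegrable _ _

/-! ### Passing from the integral to the Erdős sum. -/

theorem two_pow_cardFactors_le {n : ℕ} (hn : n ≠ 0) :
    2 ^ ArithmeticFunction.cardFactors n ≤ n := by
  conv_rhs => rw [← Nat.prod_primeFactorsList hn]
  rw [ArithmeticFunction.cardFactors_apply]
  exact List.pow_card_le_prod _ _ fun p hp => (Nat.prime_of_mem_primeFactorsList hp).two_le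

theorem two_le_of_cardFactors_eq {k n : ℕ} (hk : 1 ≤ k)
    (hn : ArithmeticFunction.cardFactors n = k) : 2 ≤ n := by
  by_contra h
  have : ArithmeticFunction.cardFactors n = 0 :=
    ArithmeticFunction.cardFactors_eq_zero_iff_eq_zero_or_one.2 (by omega)
  omega

/-- Split `n ^ (-2)`: half a power gives `2 ^ (-k/2) ≤ (4/5) ^ k`, the other `3/2` gives
summability. -/
theorem inv_sq_mul_log_le {k n : ℕ} (hk : 1 ≤ k)
    (hn : ArithmeticFunction.cardFactors n = k) :
    1 / ((n : ℝ) ^ 2 * Real.log n) ≤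
      (4 / 5) ^ k * ((Real.log 2)⁻¹ * (n : ℝ) ^ (-(3 / 2) : ℝ)) := by
  have h2 := two_le_of_cardFactors_eq hk hn
  have h2r : (2 : ℝ) ≤ n := by exact_mod_cast h2
  have hn0 : (0 : ℝ) < n := by linarith
  have hp : (2 : ℝ) ^ k ≤ n := by
    have := two_pow_cardFactors_le (n := n) (by omega)
    rw [hn] at this
    exact_mod_cast this
  have hs : (n : ℝ) ^ (-(1 / 2) : ℝ) ≤ (4 / 5) ^ k := by
    calc (n : ℝ) ^ (-(1 / 2) : ℝ) ≤ ((2 : ℝ) ^ k) ^ (-(1 / 2) : ℝ) :=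
          Real.rpow_le_rpow_of_nonpos (by positivity) hp (by norm_num)
      _ = ((2 : ℝ) ^ (-(1 / 2) : ℝ)) ^ k := by
          rw [← Real.rpow_natCast, ← Real.rpow_natCast, ← Real.rpow_mul (by norm_num),
            ← Real.rpow_mul (by norm_num), mul_comm]
      _ ≤ (4 / 5) ^ k := by
          gcongr
          rw [Real.rpow_neg (by norm_num), ← Real.sqrt_eq_rpow,
            inv_le_comm₀ (by positivity) (by norm_num)]
          exact Real.le_sqrt_of_sq_le (by norm_num)
  have hl : 0 < Real.log 2 := Real.log_pos (by norm_num)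
  have e : ((n : ℝ) ^ 2)⁻¹ = (n : ℝ) ^ (-(1 / 2) : ℝ) * (n : ℝ) ^ (-(3 / 2) : ℝ) := by
    rw [← Real.rpow_add hn0, ← Real.rpow_natCast, ← Real.rpow_neg hn0.le]; norm_num
  calc 1 / ((n : ℝ) ^ 2 * Real.log n) ≤ 1 / ((n : ℝ) ^ 2 * Real.log 2) := by gcongr
    _ = (n : ℝ) ^ (-(1 / 2) : ℝ) * ((Real.log 2)⁻¹ * (n : ℝ) ^ (-(3 / 2) : ℝ)) := by
        rw [one_div, mul_inv, e]; ring
    _ ≤ _ := by gcongr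

theorem exists_hasSum_almostPrimeTerm : ∃ C : ℝ, 0 ≤ C ∧ ∀ k : ℕ, 1 ≤ k → ∃ T : ℝ,
    HasSum (almostPrimeTerm k) ((∫ t in Set.Ioo (0 : ℝ) 1, almostPrimeZeta k t) + T) ∧
      |T| ≤ C * (4 / 5) ^ k := by
  have hl : 0 < Real.log 2 := Real.log_pos (by norm_num)
  have hsum : Summable fun n : ℕ => (Real.log 2)⁻¹ * (n : ℝ) ^ (-(3 / 2) : ℝ) :=
    (Real.summable_nat_rpow.2 (by norm_num)).mul_left _
  have h0 : ∀ n : ℕ, 0 ≤ (Real.log 2)⁻¹ * (n : ℝ) ^ (-(3 / 2) : ℝ) := fun n => by positivity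
  refine ⟨∑' n : ℕ, (Real.log 2)⁻¹ * (n : ℝ) ^ (-(3 / 2) : ℝ), tsum_nonneg h0, fun k hk => ?_⟩
  have hb (n : {n : ℕ // ArithmeticFunction.cardFactors n = k}) :=
    inv_sq_mul_log_le hk n.2
  have hnn (n : {n : ℕ // ArithmeticFunction.cardFactors n = k}) :
      0 ≤ 1 / (((n : ℕ) : ℝ) ^ 2 * Real.log (n : ℕ)) := by
    have := Real.log_natCast_nonneg (n : ℕ)
    positivity
  have hsub := (hsum.subtype {n | ArithmeticFunction.cardFactors n = k}).mul_left ((4 / 5) ^ k)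
  have hT : Summable fun n : {n : ℕ // ArithmeticFunction.cardFactors n = k} =>
      1 / (((n : ℕ) : ℝ) ^ 2 * Real.log (n : ℕ)) := .of_nonneg_of_le hnn hb hsub
  refine ⟨∑' n : {n : ℕ // ArithmeticFunction.cardFactors n = k},
    1 / (((n : ℕ) : ℝ) ^ 2 * Real.log (n : ℕ)), ?_, ?_⟩
  rotate_left
  · rw [abs_of_nonneg (tsum_nonneg hnn), mul_comm]
    refine (hT.tsum_le_tsum hb hsub).trans ?_
    rw [tsum_mul_left]
    gcongr
    exact hsum.tsum_subtype_le _ {n | ArithmeticFunction.cardFactors n = k} h0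
  · convert! (hasSum_integral_rpow k).add hT.hasSum using 1
    refine funext fun n => ?_
    have : (1 : ℝ) < (n : ℕ) := by exact_mod_cast two_le_of_cardFactors_eq hk n.2
    rw [integral_rpow_neg_one_add this, sub_add_cancel, almostPrimeTerm]

/-! ### The main estimate and conclusion. -/

open MeasureTheory Set in
theorem exists_integral_almostPrimeZeta_bound : ∃ C : ℝ, 0 ≤ C ∧ ∀ k : ℕ,
    |(∫ t in Ioo (0 : ℝ) 1, almostPrimeZeta k t) - 1| ≤ C * ((k + 1) * (4 / 5) ^ k) := by
  obtain ⟨C, hC, h⟩ := exists_regCoeff_bounds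
  refine ⟨6 * C, by positivity, fun k => ?_⟩
  set A := Finset.HasAntidiagonal.antidiagonal k with hA
  have hI : ∀ ij ∈ A, IntegrableOn (fun t : ℝ =>
      (((-Real.log t) ^ ij.1 / ij.1.factorial : ℝ) : ℂ) * regCoeff 0 ij.2) (Ioo 0 1) :=
    fun ij _ => (integrableOn_neg_log_pow ij.1).ofReal.mul_const _
  have hM : ∫ t in Ioo (0 : ℝ) 1, ∑ ij ∈ A,
      (((-Real.log t) ^ ij.1 / ij.1.factorial : ℝ) : ℂ) * regCoeff 0 ij.2 =
      ∑ j ∈ Finset.range (k + 1), regCoeff 0 j := by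
    rw [integral_finsetSum _ hI, Finset.sum_congr rfl (g := fun ij => regCoeff 0 ij.2),
      hA, Finset.Nat.sum_antidiagonal_eq_sum_range_succ_mk, ← Finset.sum_range_reflect]
    · exact Finset.sum_congr rfl fun j hj => by
        have := Finset.mem_range.1 hj
        congr 1
        omega
    · intro ij _
      rw [integral_mul_const, integral_complex_ofReal, integral_neg_log_pow, ofReal_one, one_mul]
  have h1 : ‖(∫ t in Ioo (0 : ℝ) 1, (almostPrimeZeta k t : ℂ)) -
      ∑ j ∈ Finset.range (k + 1), regCoeff 0 j‖ ≤ C * ((k + 1) * (4 / 5) ^ k) := by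
    have hP : IntegrableOn (fun t => (almostPrimeZeta k t : ℂ)) (Ioo 0 1) :=
      (integrableOn_almostPrimeZeta k).ofReal
    rw [← hM, ← integral_sub hP
      (integrable_finsetSum _ hI)]
    have hint : ∀ ij ∈ A, IntegrableOn (fun t : ℝ => (-Real.log t) ^ ij.1 / ij.1.factorial *
        t ^ 1 * (C * (4 / 5) ^ ij.2)) (Ioo 0 1) :=
      fun ij _ => (integrableOn_neg_log_pow_mul_pow ij.1 1).mul_const _
    refine (norm_integral_le_of_norm_le (g := fun t : ℝ => ∑ ij ∈ A,
      (-Real.log t) ^ ij.1 / ij.1.factorial * t ^ 1 * (C * (4 / 5) ^ ij.2))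
      (integrable_finsetSum _ hint) ?_).trans ?_
    · filter_upwards [ae_restrict_mem measurableSet_Ioo] with t ht
      rw [almostPrimeZeta_eq_sum ht.1, ← Finset.sum_sub_distrib]
      refine (norm_sum_le _ _).trans (Finset.sum_le_sum fun ij _ => ?_)
      rw [← mul_sub, norm_mul, norm_real, Real.norm_of_nonneg (neg_log_pow_nonneg ht _)]
      calc _ ≤ (-Real.log t) ^ ij.1 / ij.1.factorial * (C * t * (4 / 5) ^ ij.2) :=
            mul_le_mul_of_nonneg_left (h t ht.1.le ht.2.le _).2 (neg_log_pow_nonneg ht _)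
        _ = _ := by ring
    · rw [integral_finsetSum _ hint]
      refine (Finset.sum_le_card_nsmul A _ (C * (4 / 5) ^ k) fun ij hij => ?_).trans_eq ?_
      · rw [integral_mul_const, integral_neg_log_pow_mul_pow,
          ← Finset.HasAntidiagonal.mem_antidiagonal.1 hij, pow_add (4 / 5 : ℝ)]
        -- The weight `t` yields `2 ^ (-(i+1))`, so each of the `k + 1` terms is at most `C (4/5) ^
        -- k`.
        have : (1 / (((1 : ℕ) : ℝ) + 1)) ^ (ij.1 + 1) ≤ (4 / 5) ^ ij.1 :=
          (pow_le_pow_of_le_one (by norm_num) (by norm_num) ij.1.le_succ).trans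
            (pow_le_pow_left₀ (by norm_num) (by norm_num) _)
        calc _ ≤ (4 / 5) ^ ij.1 * (C * (4 / 5) ^ ij.2) := by gcongr
          _ = _ := by ring
      · rw [hA, Finset.Nat.card_antidiagonal, nsmul_eq_mul]
        push_cast; ring
  -- Geometric tail of the Taylor series at `z = 1`, which lies inside the disc of convergence.
  have h2 : ‖(∑ j ∈ Finset.range (k + 1), regCoeff 0 j) - 1‖ ≤
      C * (4 / 5) ^ (k + 1) / (1 - 4 / 5) := by
    refine norm_sub_le_of_geometric_bound_of_hasSum (by norm_num)
      (fun j => (h 0 le_rfl zero_le_one j).1) ?_ _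
    simpa [regFactor_zero_one] using hasSum_regCoeff le_rfl (z := 1) (by norm_num)
  rw [← Real.norm_eq_abs, ← norm_real]
  push_cast
  rw [← integral_complex_ofReal, ← sub_add_sub_cancel]
  refine (norm_add_le _ _).trans ((add_le_add h1 h2).trans ?_)
  have h3 : 0 ≤ C * (4 / 5) ^ k := by positivity
  have h4 : 0 ≤ (k : ℝ) := by positivity
  have h5 : C * (4 / 5) ^ (k + 1) / (1 - 4 / 5) = 4 * (C * (4 / 5) ^ k) := by ring
  rw [h5]
  nlinarith [mul_nonneg h3 h4]

theorem four_fifths_pow_le (k : ℕ) : (4 / 5 : ℝ) ^ k ≤ 1 / (2 : ℝ) ^ ((k : ℝ) / 4) := by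
  rw [show (k : ℝ) / 4 = (1 / 4) * k by ring, Real.rpow_mul (by norm_num), Real.rpow_natCast,
    one_div, ← inv_pow]
  gcongr
  rw [le_inv_comm₀ (by norm_num) (by positivity)]
  refine le_of_pow_le_pow_left₀ (n := 4) (by norm_num) (by norm_num) ?_
  rw [← Real.rpow_natCast, ← Real.rpow_mul (by norm_num)]
  norm_num

theorem mainTheorem5 :
    (∀ k : ℕ, 1 ≤ k → Summable (almostPrimeTerm k)) ∧
      ∃ C : ℝ, ∀ k : ℕ, 1 ≤ k →
        |erdosSum k - 1| ≤ C * ((k : ℝ) / (2 : ℝ) ^ ((k : ℝ) / 4)) := by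
  obtain ⟨C, hC, h⟩ := exists_hasSum_almostPrimeTerm
  obtain ⟨D, hD, h'⟩ := exists_integral_almostPrimeZeta_bound
  refine ⟨fun k hk => ?_, C + 2 * D, fun k hk => ?_⟩
  · obtain ⟨T, hT, -⟩ := h k hk
    exact hT.summable
  · obtain ⟨T, hT, hT'⟩ := h k hk
    have hk' : (1 : ℝ) ≤ k := by exact_mod_cast hk
    rw [erdosSum, hT.tsum_eq, add_sub_right_comm]
    have hp : (0 : ℝ) ≤ (4 / 5) ^ k := by positivity
    calc _ ≤ D * ((k + 1) * (4 / 5) ^ k) + C * (4 / 5) ^ k :=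
          (abs_add_le _ _).trans (add_le_add (h' k) hT')
      _ ≤ D * ((k + k) * (4 / 5) ^ k) + C * (k * (4 / 5) ^ k) := by
          gcongr
          exact le_mul_of_one_le_left hp hk'
      _ = (C + 2 * D) * (k * (4 / 5) ^ k) := by ring
      _ ≤ (C + 2 * D) * (k * (1 / (2 : ℝ) ^ ((k : ℝ) / 4))) := by
          gcongr
          exact four_fifths_pow_le k
      _ = _ := by ring
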